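/- All groups are abelian, written additively. For a subgroup $H$ of an abelian group $A$: $H$ is *fully invariant* if $\varphi(H)\subseteq H$ for every $\varphi\in\mathrm{End}(A)$; $H$ is *fully inert* if $H\cap\varphi(H)$ has finite index in $\varphi(H)$ (equivalently, $(H+\varphi(H))/H$ is finite) for every $\varphi\in\mathrm{End}(A)$; $H$ is *uniformly fully inert* if there is $n\in\mathbb N$ with $|(H+\varphi(H))/H|\le n$ for every $\varphi\in\mathrm{End}(A)$. Two subgroups are *commensurable* if their intersection has finite index in both. Let $\mathcal I(A)$ and $\mathcal I_u(A)$ be the sets of all fully inert, respectively uniformly fully inert, subgroups of $A$, and let $\mathrm{Inv}^{\sim}(A)$ be the set of all subgroups of $A$ that are commensurable with some fully invariant subgroup of $A$. Let $\mathfrak I$ be the class of abelian groups $A$ with $\mathcal I(A)=\mathrm{Inv}^{\sim}(A)$ and $\mathfrak I_*$ the class of abelian groups $A$ with $\mathrm{Inv}^{\sim}(A)=\mathcal I_u(A)$. Let $t(A)$ be the torsion subgroup of $A$ and $r_0(A)$ its torsion-free rank, i.e. the cardinality of any maximal independent set of elements of infinite order. **Corollary.** Let $D$ be a divisible abelian group.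 Then $D\in\mathfrak I_*$; in particular, every uniformly fully inert subgroup of $D$ is commensurable with a fully invariant subgroup of $D$. Moreover, $$\mathrm{Inv}^{\sim}(t(D))\cup\{D\}=\mathrm{Inv}^{\sim}(D),$$ where subgroups of $t(D)$ are regarded as subgroups of $D$, and: 1. if $0<r_0(D)<\infty$, then $\mathcal I(D)\ne\mathcal I_u(D)=\mathrm{Inv}^{\sim}(D)$; 2. otherwise (that is, if $r_0(D)=0$ or $r_0(D)$ is infinite), $\mathcal I(D)=\mathcal I_u(D)=\mathrm{Inv}^{\sim}(D)$, hence $D\in\mathfrak I$. -/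

import Mathlib

namespace FullyInert

variable {A : Type*} [AddCommGroup A]

/-- A subgroup is fully invariant if every endomorphism of the group maps it into itself. -/
def IsFullyInvariant (H : AddSubgroup A) : Prop :=
  ∀ φ : A →+ A, H.map φ ≤ H

/-- `H` is `φ`-inert if `H ∩ φ(H)` has finite index in `φ(H)`.
(The natural number `H.relIndex K` is the index of `H ∩ K` in `K`, and is `0` exactly when that
index is infinite.) -/
def IsInertFor (φ : A →+ A) (H : AddSubgroup A) : Prop :=
  H.relIndex (H.map φ) ≠ 0

/-- A subgroup is fully inert if it is `φ`-inert for every endomorphism `φ` of the group. -/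
def IsFullyInert (H : AddSubgroup A) : Prop :=
  ∀ φ : A →+ A, IsInertFor φ H

/-- A subgroup `H` is uniformly fully inert if there is a natural number `n` such that, for every
endomorphism `φ`, the quotient `(H + φ(H)) / H` is finite with at most `n` elements. -/
def IsUniformlyFullyInert (H : AddSubgroup A) : Prop :=
  ∃ n : ℕ, ∀ φ : A →+ A, H.relIndex (H ⊔ H.map φ) ≠ 0 ∧ H.relIndex (H ⊔ H.map φ) ≤ n

variable (A)

/-- The set `I(A)` of all fully inert subgroups of `A`. -/
def fullyInertSubgroups : Set (AddSubgroup A) := {H | IsFullyInert H}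

/-- The set `I_u(A)` of all uniformly fully inert subgroups of `A`. -/
def uniformlyFullyInertSubgroups : Set (AddSubgroup A) := {H | IsUniformlyFullyInert H}

/-- The set `Inv^~(A)` of all subgroups of `A` that are commensurable with some fully invariant
subgroup of `A`. -/
def invSim : Set (AddSubgroup A) :=
  {H | ∃ K : AddSubgroup A, IsFullyInvariant K ∧ H.Commensurable K}

/-- Membership in the class `𝔍`: `I(A) = Inv^~(A)`. -/
def InClassI : Prop := fullyInertSubgroups A = invSim A

/-- Membership in the class `𝔍_*`: `Inv^~(A) = I_u(A)`. -/
def InClassIStar : Prop := invSim A = uniformlyFullyInertSubgroups A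

/-- The torsion-free rank `r_0(A)`: a family of elements of `A` is linearly independent over `ℤ`
if and only if it is an independent family of elements of infinite order. -/
noncomputable def torsionFreeRank : Cardinal := Module.rank ℤ A

end FullyInert

namespace FullyInert

universe u v

/-! ### Inertness under commensurability. -/

section General

variable {A : Type*} [AddCommGroup A]

/-! A divisible group is injective, so endomorphisms can be prescribed on subgroups
(`exists_extension`). If `N • φ(H) ≤ H` for all `φ` with one `N > 0`, an element of infinite order
in `H` can be sent anywhere, so `H` contains `N • D = D`. Uniform inertness supplies such an `N`; in
infinite rank full inertness alone already forces `H = ⊤`. In finite positive rank, the torsion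
subgroup plus a free subgroup of maximal rank is fully inert but not uniformly so. For torsion `H`,
full inertness still yields a common `N`, by a diagonal construction
(`IsFullyInert.exists_isInvariantUpTo`). The primes of `N` are then removed one at a time, replacing
`H` by a commensurable hull or core (`IsFullyInert.relIndex_invariantHull_or_invariantCore`); at `N
= 1` the subgroup is fully invariant. -/

theorem relIndex_eq_zero_of_sequence {H K : AddSubgroup A} (y : ℕ → A) (hy : ∀ n, y n ∈ K)
    (hne : ∀ m n, m ≠ n → y m - y n ∉ H) : H.relIndex K = 0 := by
  by_contra h
  have : Finite (K ⧸ H.addSubgroupOf K) :=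
    @AddSubgroup.finite_quotient_of_finiteIndex _ _ (H.addSubgroupOf K) ⟨h⟩
  refine not_injective_infinite_finite
    (fun n : ℕ ↦ ((⟨y n, hy n⟩ : K) : K ⧸ H.addSubgroupOf K)) fun m n hmn ↦ ?_
  by_contra hmn'
  refine hne n m (Ne.symm hmn') ?_
  have h2 := QuotientAddGroup.eq.1 hmn
  rw [AddSubgroup.mem_addSubgroupOf] at h2
  simpa [neg_add_eq_sub] using h2

theorem exists_sequence_of_relIndex_eq_zero {H K : AddSubgroup A} (h : H.relIndex K = 0) :
    ∃ y : ℕ → A, (∀ n, y n ∈ K) ∧ ∀ m n, m ≠ n → y m - y n ∉ H := by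
  have : Infinite (K ⧸ H.addSubgroupOf K) := by
    rw [← not_finite_iff_infinite]
    intro hfin
    exact (AddSubgroup.finiteIndex_of_finite_quotient (H := H.addSubgroupOf K)).index_ne_zero h
  let e := Infinite.natEmbedding (K ⧸ H.addSubgroupOf K)
  refine ⟨fun n ↦ ((e n).out : K), fun n ↦ (e n).out.2, fun m n hmn hmem ↦ hmn ?_⟩
  refine e.injective ?_
  rw [← QuotientAddGroup.out_eq' (e m), ← QuotientAddGroup.out_eq' (e n), eq_comm,
    QuotientAddGroup.eq, AddSubgroup.mem_addSubgroupOf]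
  simpa [neg_add_eq_sub] using hmem

theorem relIndex_map_ne_zero_and_le {H K : AddSubgroup A} (h : H.relIndex K ≠ 0) (φ : A →+ A) :
    (H.map φ).relIndex (K.map φ) ≠ 0 ∧ (H.map φ).relIndex (K.map φ) ≤ H.relIndex K := by
  have h1 : (H ⊔ φ.ker).relIndex (K ⊔ (H ⊔ φ.ker)) ≠ 0 := by
    rw [AddSubgroup.relIndex_sup_right]
    exact fun h0 ↦ h (AddSubgroup.relIndex_eq_zero_of_le_left le_sup_left h0)
  have hle : K ⊔ φ.ker ≤ K ⊔ (H ⊔ φ.ker) := sup_le_sup_left le_sup_right K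
  rw [AddSubgroup.relIndex_map_map]
  refine ⟨fun h0 ↦ h1 (AddSubgroup.relIndex_eq_zero_of_le_right hle h0),
    (AddSubgroup.relIndex_le_of_le_right hle h1).trans ?_⟩
  rw [AddSubgroup.relIndex_sup_right]
  exact AddSubgroup.relIndex_le_of_le_left le_sup_left h

theorem IsFullyInert.of_commensurable {H K : AddSubgroup A} (hH : IsFullyInert H)
    (hHK : H.Commensurable K) : IsFullyInert K := fun φ ↦
  AddSubgroup.relIndex_ne_zero_trans hHK.2
    (AddSubgroup.relIndex_ne_zero_trans (hH φ) (relIndex_map_ne_zero_and_le hHK.1 φ).1)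

theorem IsFullyInvariant.isUniformlyFullyInert_of_commensurable {H K : AddSubgroup A}
    (hK : IsFullyInvariant K) (hHK : H.Commensurable K) : IsUniformlyFullyInert H := by
  -- Since `φ(H ⊓ K) ≤ K`, the first factor bounds the index of `H` in `φ(H ⊓ K)`; the second bounds
  -- that of `φ(H ⊓ K)` in `φ(H)`.
  refine ⟨H.relIndex K * K.relIndex H, fun φ ↦ ?_⟩
  rw [AddSubgroup.relIndex_sup_left]
  obtain ⟨h1, h2⟩ := relIndex_map_ne_zero_and_le (H := H ⊓ K) (K := H)
    (by rw [AddSubgroup.inf_relIndex_left]; exact hHK.2) φ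
  rw [AddSubgroup.inf_relIndex_left] at h2
  have hle : (H ⊓ K).map φ ≤ K := (AddSubgroup.map_mono inf_le_right).trans (hK φ)
  have h3 : H.relIndex ((H ⊓ K).map φ) ≠ 0 :=
    fun h0 ↦ hHK.1 (AddSubgroup.relIndex_eq_zero_of_le_right hle h0)
  have h4 := AddSubgroup.relIndex_le_of_le_right hle hHK.1
  have h5 := AddSubgroup.relIndex_ne_zero_trans h3 h1
  refine ⟨h5, ?_⟩
  have h6 := AddSubgroup.relIndex_inf_mul_relIndex H ((H ⊓ K).map φ) (H.map φ)
  rw [inf_eq_left.2 (AddSubgroup.map_mono inf_le_left)] at h6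
  refine le_trans ?_ (Nat.mul_le_mul h4 h2)
  rw [h6]
  exact AddSubgroup.relIndex_le_of_le_left inf_le_left (by rw [← h6]; exact mul_ne_zero h3 h1)

theorem IsUniformlyFullyInert.isFullyInert {H : AddSubgroup A} (hH : IsUniformlyFullyInert H) :
    IsFullyInert H := fun φ ↦ by
  obtain ⟨n, hn⟩ := hH
  have := (hn φ).1
  rwa [AddSubgroup.relIndex_sup_left] at this

end General

/-! ### Injectivity of divisible groups. -/

section Divisible

variable {D : Type u} [AddCommGroup D] [DivisibleBy D ℤ]

theorem exists_extension {F : Type v} [AddCommGroup F] (a b : F →+ D) (h : a.ker ≤ b.ker) :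
    ∃ φ : D →+ D, ∀ x, φ (a x) = b x := by
  let e := QuotientAddGroup.quotientKerEquivRange a
  obtain ⟨φ, hφ⟩ := (Module.Baer.of_divisible D).extension_property_addMonoidHom
    a.range.subtype a.range.subtype_injective
    ((QuotientAddGroup.lift a.ker b h).comp e.symm.toAddMonoidHom)
  refine ⟨φ, fun x ↦ ?_⟩
  have := DFunLike.congr_fun hφ (a.rangeRestrict x)
  have h2 : e.symm (a.rangeRestrict x) = (x : F ⧸ a.ker) := by
    rw [AddEquiv.symm_apply_eq]; rfl
  simpa [h2] using this

end Divisible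

/-! ### Invariance up to a factor, and elements of infinite order. -/

section Divisible

variable {D : Type u} [AddCommGroup D]

/-- `H` contains `N • φ(H)` for every endomorphism `φ`. -/
def IsInvariantUpTo (N : ℕ) (H : AddSubgroup D) : Prop :=
  ∀ φ : D →+ D, ∀ h ∈ H, N • φ h ∈ H

theorem exists_nsmul_mem_of_relIndex_le {H K : AddSubgroup D} {n : ℕ} (h0 : H.relIndex K ≠ 0)
    (hn : H.relIndex K ≤ n) {x : D} (hx : x ∈ K) : n.factorial • x ∈ H :=
  (AddSubgroup.nsmul_mem_of_relIndex_ne_zero_of_dvd h0 hx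
    fun _ hm hle ↦ Nat.dvd_factorial hm (hle.trans hn)).1

theorem IsFullyInert.exists_nsmul_mem {H : AddSubgroup D} (hH : IsFullyInert H) (φ : D →+ D) :
    ∃ n : ℕ, 0 < n ∧ ∀ h ∈ H, n • φ h ∈ H :=
  ⟨_, Nat.factorial_pos _, fun _ hh ↦ exists_nsmul_mem_of_relIndex_le (hH φ) le_rfl
    (AddSubgroup.mem_map_of_mem φ hh)⟩

theorem IsUniformlyFullyInert.exists_isInvariantUpTo {H : AddSubgroup D}
    (hH : IsUniformlyFullyInert H) : ∃ N : ℕ, 0 < N ∧ IsInvariantUpTo N H := by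
  obtain ⟨n, hn⟩ := hH
  exact ⟨_, Nat.factorial_pos n, fun φ h hh ↦ exists_nsmul_mem_of_relIndex_le (hn φ).1 (hn φ).2
    (AddSubgroup.mem_sup_right (AddSubgroup.mem_map_of_mem φ hh))⟩

theorem zsmul_eq_zero_iff_of_infinite_order {x : D} (hx : ¬ IsOfFinAddOrder x) {n : ℤ} :
    n • x = 0 ↔ n = 0 := by
  refine ⟨fun h ↦ ?_, fun h ↦ by rw [h, zero_smul]⟩
  by_contra hn
  exact hx (isOfFinAddOrder_iff_zsmul_eq_zero.2 ⟨n, hn, h⟩)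

variable [DivisibleBy D ℤ]

theorem exists_apply_eq_of_infinite_order {x : D} (hx : ¬ IsOfFinAddOrder x) (d : D) :
    ∃ φ : D →+ D, φ x = d := by
  obtain ⟨φ, hφ⟩ := exists_extension (zmultiplesHom D x) (zmultiplesHom D d) fun n hn ↦ by
    have : n • x = 0 := by simpa using hn
    simp [(zsmul_eq_zero_iff_of_infinite_order hx).1 this]
  exact ⟨φ, by simpa using hφ 1⟩

theorem exists_nsmul_eq {n : ℕ} (hn : 0 < n) (d : D) : ∃ y : D, n • y = d :=
  ⟨DivisibleBy.div d (n : ℤ), by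
    rw [← natCast_zsmul]; exact DivisibleBy.div_cancel d (by exact_mod_cast hn.ne')⟩

theorem eq_top_of_nsmul_mem {H : AddSubgroup D} {N : ℕ} (hN : 0 < N) (h : ∀ d : D, N • d ∈ H) :
    H = ⊤ := by
  refine (AddSubgroup.eq_top_iff' H).2 fun d ↦ ?_
  obtain ⟨y, rfl⟩ := exists_nsmul_eq hN d
  exact h y

theorem eq_top_of_relIndex_top_ne_zero {H : AddSubgroup D} (h : H.relIndex ⊤ ≠ 0) : H = ⊤ :=
  eq_top_of_nsmul_mem (Nat.factorial_pos _) fun _ ↦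
    exists_nsmul_mem_of_relIndex_le h le_rfl (AddSubgroup.mem_top _)

theorem IsInvariantUpTo.eq_top {H : AddSubgroup D} {N : ℕ} (hN : 0 < N)
    (hH : IsInvariantUpTo N H) {x : D} (hxH : x ∈ H) (hx : ¬ IsOfFinAddOrder x) : H = ⊤ := by
  refine eq_top_of_nsmul_mem hN fun d ↦ ?_
  obtain ⟨φ, rfl⟩ := exists_apply_eq_of_infinite_order hx d
  exact hH φ x hxH

/-- The kernel condition makes `a(e_n) ↦ y n` extend to an endomorphism. With the `y n` pairwise
incongruent modulo `H`, the image of `H` would meet infinitely many cosets of `H`. -/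
theorem IsFullyInert.relIndex_ne_zero_of_lift {H K : AddSubgroup D} (hH : IsFullyInert H)
    (a : (ℕ →₀ ℤ) →+ D) (ha : ∀ c, a c ∈ H)
    (h : ∀ y : ℕ → D, (∀ n, y n ∈ K) →
      a.ker ≤ (Finsupp.linearCombination ℤ y).toAddMonoidHom.ker) : H.relIndex K ≠ 0 := by
  intro h0
  obtain ⟨y, hyK, hy⟩ := exists_sequence_of_relIndex_eq_zero h0
  obtain ⟨φ, hφ⟩ := exists_extension a _ (h y hyK)
  refine hH φ (relIndex_eq_zero_of_sequence y (fun n ↦ ?_) hy)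
  exact ⟨a (Finsupp.single n 1), ha _, by simpa using hφ (Finsupp.single n 1)⟩

theorem IsFullyInert.eq_top_of_linearIndependent {H : AddSubgroup D} (hH : IsFullyInert H)
    {d : ℕ → D} (hd : LinearIndependent ℤ d) {x : D} (hxH : x ∈ H) (hx : ¬ IsOfFinAddOrder x) :
    H = ⊤ := by
  have hm : ∀ i, ∃ m : ℕ, 0 < m ∧ m • d i ∈ H := fun i ↦ by
    obtain ⟨φ, hφ⟩ := exists_apply_eq_of_infinite_order hx (d i)
    obtain ⟨m, hm, h⟩ := hH.exists_nsmul_mem φ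
    exact ⟨m, hm, hφ ▸ h x hxH⟩
  choose m hm hmH using hm
  have hind : LinearIndependent ℤ fun i ↦ m i • d i := by
    rw [linearIndependent_iff'] at hd ⊢
    intro s g hg i hi
    have := hd s (fun i ↦ g i * m i) (by rw [← hg]; simp [mul_smul]) i hi
    exact (mul_eq_zero.1 this).resolve_right (by exact_mod_cast (hm i).ne')
  refine eq_top_of_relIndex_top_ne_zero (hH.relIndex_ne_zero_of_lift
    (Finsupp.linearCombination ℤ fun i ↦ m i • d i).toAddMonoidHom (fun c ↦ ?_) fun y _ c hc ↦ ?_)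
  · simp only [LinearMap.toAddMonoidHom_coe, Finsupp.linearCombination_apply]
    exact AddSubgroup.sum_mem _ fun i _ ↦ H.zsmul_mem (hmH i) _
  · have : c = 0 := linearIndependent_iff.1 hind c hc
    simp [this]

/-- Corrections after stage `k` vanish on elements killed by `M k`, and every torsion element is
killed at some stage, so the `ψ k` stabilise pointwise on the torsion subgroup. Injectivity extends
the limit. -/
theorem exists_eventual_limit (M : ℕ → ℕ) (ψ : ℕ → D →+ D) (hM : ∀ k, M k ∣ M (k + 1))
    (hM' : ∀ k, k + 1 ∣ M (k + 1)) (hψ : ∀ k, ∃ θ : D →+ D, ψ (k + 1) = ψ k + M k • θ) :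
    ∃ φ : D →+ D, ∀ k x, IsOfFinAddOrder x → M k • x = 0 → φ x = ψ k x := by
  have hkill : ∀ k x, M k • x = 0 → ∀ j, k ≤ j → M j • x = 0 ∧ ψ j x = ψ k x := by
    intro k x hx j hj
    induction j, hj using Nat.le_induction with
    | base => exact ⟨hx, rfl⟩
    | succ j _ ih =>
      obtain ⟨c, hc⟩ := hM j
      obtain ⟨θ, hθ⟩ := hψ j
      refine ⟨by rw [hc, mul_comm, mul_smul, ih.1, smul_zero], ?_⟩
      rw [hθ, AddMonoidHom.add_apply, AddMonoidHom.nsmul_apply, ← map_nsmul, ih.1, map_zero,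
        add_zero, ih.2]
  have hex : ∀ x : AddCommGroup.torsion D, M (addOrderOf (x : D)) • (x : D) = 0 := fun x ↦ by
    have hpos : 0 < addOrderOf (x : D) := x.2.addOrderOf_pos
    obtain ⟨c, hc⟩ := hM' (addOrderOf (x : D) - 1)
    rw [Nat.sub_add_cancel hpos] at hc
    rw [hc, mul_comm, mul_smul, addOrderOf_nsmul_eq_zero, smul_zero]
  have heq : ∀ (x : AddCommGroup.torsion D) k, M k • (x : D) = 0 →
      ψ (addOrderOf (x : D)) x = ψ k x := fun x k hk ↦ by
    rw [← (hkill _ _ (hex x) _ (le_max_left _ k)).2, ← (hkill _ _ hk _ (le_max_right _ k)).2]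
  let f : AddCommGroup.torsion D →+ D :=
    { toFun := fun x ↦ ψ (addOrderOf (x : D)) x
      map_zero' := by simp
      map_add' := fun x y ↦ by
        have hx := (hkill _ _ (hex x) _ (le_max_left _ (addOrderOf (y : D)))).1
        have hy := (hkill _ _ (hex y) _ (le_max_right (addOrderOf (x : D)) _)).1
        rw [heq x _ hx, heq y _ hy, heq (x + y) _ (by
          rw [AddSubgroup.coe_add, smul_add, hx, hy, add_zero]), AddSubgroup.coe_add, map_add] }
  obtain ⟨φ, hφ⟩ := exists_extension (AddCommGroup.torsion D).subtype f
    (by rw [AddSubgroup.ker_subtype]; exact bot_le)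
  exact ⟨φ, fun k x hx hk ↦ (hφ ⟨x, hx⟩).trans (heq ⟨x, hx⟩ k hk)⟩

theorem IsFullyInert.exists_isInvariantUpTo {H : AddSubgroup D} (hH : IsFullyInert H)
    (ht : ∀ h ∈ H, IsOfFinAddOrder h) : ∃ N : ℕ, 0 < N ∧ IsInvariantUpTo N H := by
  by_contra! hcon
  simp only [IsInvariantUpTo, not_forall] at hcon
  have step : ∀ (k : ℕ) (s : ℕ+ × (D →+ D)), ∃ s' : ℕ+ × (D →+ D),
      (s.1 : ℕ) ∣ s'.1 ∧ k + 1 ∣ (s'.1 : ℕ) ∧ (∃ θ : D →+ D, s'.2 = s.2 + (s.1 : ℕ) • θ) ∧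
      ∃ h ∈ H, (k + 1) • s'.2 h ∉ H ∧ (s'.1 : ℕ) • h = 0 := by
    rintro k ⟨M, ψ⟩
    -- If `ψ` already fails at factor `k + 1`, no correction is needed; otherwise a failure at
    -- factor `(k + 1) * M` supplies `θ`.
    obtain ⟨θ, h, hh, hn⟩ : ∃ θ : D →+ D, ∃ h ∈ H, (k + 1) • (ψ + (M : ℕ) • θ) h ∉ H := by
      by_cases hψ : ∃ h ∈ H, (k + 1) • ψ h ∉ H
      · obtain ⟨h, hh, hn⟩ := hψ
        exact ⟨0, h, hh, by simpa using hn⟩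
      · push Not at hψ
        obtain ⟨θ, h, hh, hn⟩ := hcon ((k + 1) * M) (Nat.mul_pos k.succ_pos M.pos)
        refine ⟨θ, h, hh, fun hmem ↦ hn ?_⟩
        rw [AddMonoidHom.add_apply, smul_add, AddMonoidHom.nsmul_apply, ← mul_smul] at hmem
        exact (H.add_mem_cancel_left (hψ h hh)).1 hmem
    obtain ⟨o, ho⟩ : ∃ o : ℕ+, (o : ℕ) = addOrderOf h := ⟨⟨_, (ht h hh).addOrderOf_pos⟩, rfl⟩
    -- The factor `o` makes the new modulus kill `h`, freezing the value at `h` in all later stages.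
    refine ⟨⟨M * k.succPNat * o, ψ + (M : ℕ) • θ⟩, ?_, ?_, ⟨θ, rfl⟩, h, hh, hn, ?_⟩
    · simp [mul_assoc]
    · simp only [PNat.mul_coe, Nat.succPNat_coe]
      exact (Dvd.intro_left _ rfl).mul_right _
    · simp only [PNat.mul_coe]
      rw [mul_smul, ho, addOrderOf_nsmul_eq_zero, smul_zero]
  choose next h1 h2 h3 h4 using step
  let s : ℕ → ℕ+ × (D →+ D) := fun n ↦ Nat.rec (1, 0) (fun k t ↦ next k t) n
  obtain ⟨φ, hφ⟩ := exists_eventual_limit (fun k ↦ ((s k).1 : ℕ)) (fun k ↦ (s k).2)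
    (fun k ↦ h1 k (s k)) (fun k ↦ h2 k (s k)) (fun k ↦ h3 k (s k))
  obtain ⟨n, hn, hnφ⟩ := hH.exists_nsmul_mem φ
  obtain ⟨k, rfl⟩ := Nat.exists_eq_add_of_lt hn
  obtain ⟨h, hh, hnot, hz⟩ := h4 (0 + k) (s (0 + k))
  refine hnot ?_
  have := hφ (0 + k + 1) h (ht h hh) hz
  rw [show (next (0 + k) (s (0 + k))).2 h = φ h from this.symm]
  exact hnφ h hh

end Divisible

/-! ### Torsion subgroups: removing one prime from the factor. -/

section Divisible

variable {D : Type u} [AddCommGroup D]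

/-- The subgroup generated by `H` and all the subgroups `N • φ(H)`. -/
def invariantHull (N : ℕ) (H : AddSubgroup D) : AddSubgroup D :=
  H ⊔ ⨆ φ : D →+ D, H.map (N • φ)

/-- The elements `h` of `H` such that `N • φ h` is in `H` for every endomorphism `φ`. -/
def invariantCore (N : ℕ) (H : AddSubgroup D) : AddSubgroup D :=
  H ⊓ ⨅ φ : D →+ D, H.comap (N • φ)

theorem le_invariantHull (N : ℕ) (H : AddSubgroup D) : H ≤ invariantHull N H := le_sup_left

theorem invariantCore_le (N : ℕ) (H : AddSubgroup D) : invariantCore N H ≤ H := inf_le_left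

theorem mem_invariantCore {N : ℕ} {H : AddSubgroup D} {h : D} :
    h ∈ invariantCore N H ↔ h ∈ H ∧ ∀ φ : D →+ D, N • φ h ∈ H := by
  simp [invariantCore, AddSubgroup.mem_inf, AddSubgroup.mem_iInf]

theorem isInvariantUpTo_invariantCore (N : ℕ) (H : AddSubgroup D) :
    IsInvariantUpTo N (invariantCore N H) := fun φ h hh ↦ by
  rw [mem_invariantCore] at hh ⊢
  refine ⟨hh.2 φ, fun ψ ↦ ?_⟩
  simpa using hh.2 (ψ.comp (N • φ))

theorem isInvariantUpTo_invariantHull (N : ℕ) (H : AddSubgroup D) :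
    IsInvariantUpTo N (invariantHull N H) := fun φ h hh ↦ by
  have hmem : ∀ ψ : D →+ D, ∀ x ∈ H, N • ψ x ∈ invariantHull N H := fun ψ x hx ↦
    AddSubgroup.mem_sup_right (AddSubgroup.mem_iSup_of_mem ψ ⟨x, hx, rfl⟩)
  have hle : invariantHull N H ≤ (invariantHull N H).comap (N • φ) := by
    refine sup_le (fun x hx ↦ hmem φ x hx) (iSup_le fun ψ ↦ ?_)
    rintro _ ⟨x, hx, rfl⟩
    simpa using hmem (φ.comp (N • ψ)) x hx
  exact hle hh

theorem isOfFinAddOrder_of_mem_invariantHull {N : ℕ} {H : AddSubgroup D}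
    (ht : ∀ h ∈ H, IsOfFinAddOrder h) : ∀ h ∈ invariantHull N H, IsOfFinAddOrder h := by
  have hle : invariantHull N H ≤ AddCommGroup.torsion D := by
    refine sup_le ht (iSup_le fun ψ ↦ ?_)
    rintro _ ⟨x, hx, rfl⟩
    exact AddMonoidHom.isOfFinAddOrder _ (ht x hx)
  exact hle

theorem IsInvariantUpTo.nsmul_mem_invariantCore {p N : ℕ} {H : AddSubgroup D}
    (hH : IsInvariantUpTo (p * N) H) {h : D} (hh : h ∈ H) : p • h ∈ invariantCore N H := by
  refine mem_invariantCore.2 ⟨H.nsmul_mem hh p, fun φ ↦ ?_⟩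
  rw [map_nsmul, ← mul_smul, mul_comm]
  exact hH φ h hh

theorem exists_linearIndependent_of_infinite (k V : Type*) [Field k] [Finite k] [AddCommGroup V]
    [Module k V] [Infinite V] : ∃ v : ℕ → V, LinearIndependent k v := by
  let b := Module.Basis.ofVectorSpace k V
  have hι : Infinite (Module.Basis.ofVectorSpaceIndex k V) := by
    rw [← not_finite_iff_infinite]
    intro hfin
    have := Module.Finite.of_basis b
    have := Module.finite_of_finite k (M := V)
    exact not_finite V
  exact ⟨_, b.linearIndependent.comp _ (Infinite.natEmbedding _).injective⟩

theorem exists_independent_mod {p : ℕ} (hp : p.Prime) {H L : AddSubgroup D}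
    (hpH : ∀ h ∈ H, p • h ∈ L) (h0 : L.relIndex H = 0) :
    ∃ h : ℕ → D, (∀ i, h i ∈ H) ∧ ∀ (s : Finset ℕ) (g : ℕ → ℤ), ∑ i ∈ s, g i • h i ∈ L →
      ∀ i ∈ s, (p : ℤ) ∣ g i := by
  have := Fact.mk hp
  have hinf : Infinite (H ⧸ L.addSubgroupOf H) := by
    rw [← not_finite_iff_infinite]
    intro hfin
    exact (AddSubgroup.finiteIndex_of_finite_quotient (H := L.addSubgroupOf H)).index_ne_zero h0
  let _ : Module (ZMod p) (H ⧸ L.addSubgroupOf H) :=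
    QuotientAddGroup.zmodModule fun x ↦ hpH x x.2
  obtain ⟨v, hv⟩ := exists_linearIndependent_of_infinite (ZMod p) (H ⧸ L.addSubgroupOf H)
  refine ⟨fun i ↦ ((v i).out : H), fun i ↦ (v i).out.2, fun s g hg i hi ↦ ?_⟩
  rw [← ZMod.intCast_zmod_eq_zero_iff_dvd]
  refine linearIndependent_iff'.1 hv s (fun i ↦ ((g i : ℤ) : ZMod p)) ?_ i hi
  have h1 : QuotientAddGroup.mk' (L.addSubgroupOf H) (∑ i ∈ s, g i • ((v i).out : H)) = 0 := by
    rw [QuotientAddGroup.mk'_apply, QuotientAddGroup.eq_zero_iff, AddSubgroup.mem_addSubgroupOf]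
    simpa using hg
  rw [← h1, map_sum]
  refine Finset.sum_congr rfl fun i _ ↦ ?_
  rw [map_zsmul, QuotientAddGroup.mk'_apply, QuotientAddGroup.out_eq', Int.cast_smul_eq_zsmul]

theorem exists_nsmul_addOrderOf_eq_prime_pow {p : ℕ} (hp : p.Prime) {h : D}
    (ht : IsOfFinAddOrder h) :
    ∃ m e : ℕ, m.Coprime p ∧ addOrderOf (m • h) = p ^ e := by
  obtain ⟨e, m, hm, hpm⟩ := Nat.exists_eq_pow_mul_and_not_dvd ht.addOrderOf_pos.ne' p hp.ne_one
  refine ⟨m, e, ((hp.coprime_iff_not_dvd.2 hm).symm), ?_⟩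
  have hm0 : m ≠ 0 := by rintro rfl; simp at hm
  rw [addOrderOf_nsmul_of_dvd hm0 (hpm ▸ Dvd.intro_left _ rfl), hpm,
    Nat.mul_div_cancel _ (Nat.pos_of_ne_zero hm0)]

variable [DivisibleBy D ℤ]

theorem exists_apply_eq_of_addOrderOf {x d : D} (h : addOrderOf x • d = 0) :
    ∃ φ : D →+ D, φ x = d := by
  obtain ⟨φ, hφ⟩ := exists_extension (zmultiplesHom D x) (zmultiplesHom D d) fun n hn ↦ by
    have : n • x = 0 := by simpa using hn
    obtain ⟨c, rfl⟩ := addOrderOf_dvd_iff_zsmul_eq_zero.2 this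
    simp [mul_comm _ c, mul_smul, h]
  exact ⟨φ, by simpa using hφ 1⟩

theorem IsInvariantUpTo.mem_invariantCore_of_lt {p N : ℕ} (hp : p.Prime) {H : AddSubgroup D}
    (hH : IsInvariantUpTo (p * N) H) {h h' : D} (hh : h ∈ H) (hh' : h' ∈ H) {e e' : ℕ}
    (he : addOrderOf h = p ^ e) (he' : addOrderOf h' = p ^ e') (hlt : e < e') :
    h ∈ invariantCore N H := by
  obtain ⟨k, rfl⟩ := Nat.exists_eq_add_of_lt hlt
  have h1 : addOrderOf (p • h') = p ^ (e + k) := by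
    rw [addOrderOf_nsmul_of_dvd hp.ne_zero (he' ▸ dvd_pow_self p (by simp)), he', pow_succ,
      Nat.mul_div_cancel _ hp.pos]
  obtain ⟨ψ, hψ⟩ := exists_apply_eq_of_addOrderOf (x := p • h') (d := h) (by
    rw [h1, pow_add, mul_comm, mul_smul, ← he, addOrderOf_nsmul_eq_zero, smul_zero])
  refine mem_invariantCore.2 ⟨hh, fun φ ↦ ?_⟩
  rw [← hψ, map_nsmul, map_nsmul, ← mul_smul, mul_comm]
  exact hH (φ.comp ψ) h' hh'

/-- If both indices were infinite, `H` modulo its core would be an infinite `𝔽_p`-space, and `H`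
would have infinite index in the hull. Independent classes could then be sent to arbitrary elements
of `D[p^e]`, which represent infinitely many cosets of `H`. -/
theorem IsFullyInert.relIndex_invariantHull_or_invariantCore {p N : ℕ} (hp : p.Prime)
    {H : AddSubgroup D} (hH : IsFullyInert H) (ht : ∀ h ∈ H, IsOfFinAddOrder h)
    (hN : IsInvariantUpTo (p * N) H) :
    H.relIndex (invariantHull N H) ≠ 0 ∨ (invariantCore N H).relIndex H ≠ 0 := by
  by_contra! hcon
  obtain ⟨hhull, hcore⟩ := hcon
  -- By Bézout, as `p • h` lies in the core, clearing the prime-to-`p` part of the order does not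
  -- move `h` into the core.
  have hscale : ∀ h ∈ H, h ∉ invariantCore N H → ∃ m e : ℕ, m.Coprime p ∧
      addOrderOf (m • h) = p ^ e ∧ m • h ∉ invariantCore N H := fun h hh hn ↦ by
    obtain ⟨m, e, hm, he⟩ := exists_nsmul_addOrderOf_eq_prime_pow hp (ht h hh)
    refine ⟨m, e, hm, he, fun hmem ↦ hn ?_⟩
    obtain ⟨u, v, huv⟩ := Int.isCoprime_iff_gcd_eq_one.2 (by simpa using hm :
      Int.gcd (m : ℤ) p = 1)
    have : h = u • (m • h) + v • (p • h) := by
      rw [← natCast_zsmul h m, ← natCast_zsmul h p, ← mul_smul, ← mul_smul, ← add_smul, huv,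
        one_smul]
    rw [this]
    exact add_mem (zsmul_mem hmem u) (zsmul_mem (hN.nsmul_mem_invariantCore hh) v)
  obtain ⟨h', hh', hind⟩ := exists_independent_mod hp
    (fun h hh ↦ hN.nsmul_mem_invariantCore hh) hcore
  have hnot : ∀ i, h' i ∉ invariantCore N H := fun i hi ↦ by
    have := hind {i} 1 (by simpa using hi) i (by simp)
    exact hp.one_lt.ne' (by exact_mod_cast Int.eq_one_of_dvd_one (by positivity) this)
  choose m ε hm hε hm' using fun i ↦ hscale (h' i) (hh' i) (hnot i)
  -- Of two elements of `H` with distinct `p`-power orders, the one of smaller order is in the core,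
  -- so outside the core only one exponent occurs.
  obtain ⟨e, he⟩ : ∃ e, ∀ h ∈ H, h ∉ invariantCore N H → ∀ j, addOrderOf h = p ^ j → j = e := by
    refine ⟨ε 0, fun h hh hn j hj ↦ ?_⟩
    rcases lt_trichotomy j (ε 0) with hlt | heq | hlt
    · exact (hn (hN.mem_invariantCore_of_lt hp hh (H.nsmul_mem (hh' 0) _) hj (hε 0) hlt)).elim
    · exact heq
    · exact (hm' 0 (hN.mem_invariantCore_of_lt hp (H.nsmul_mem (hh' 0) _) hh (hε 0) hj hlt)).elim
  let T : AddSubgroup D := (nsmulAddMonoidHom (p ^ e) : D →+ D).ker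
  have hT : ∀ x, x ∈ T ↔ p ^ e • x = 0 := fun x ↦ Iff.rfl
  have hle : invariantHull N H ≤ H ⊔ T := by
    refine sup_le le_sup_left (iSup_le fun φ ↦ ?_)
    rintro _ ⟨h, hh, rfl⟩
    rw [AddMonoidHom.nsmul_apply]
    by_cases hc : h ∈ invariantCore N H
    · exact AddSubgroup.mem_sup_left ((mem_invariantCore.1 hc).2 φ)
    · obtain ⟨m, j, hm, hj, hmc⟩ := hscale h hh hc
      obtain rfl := he _ (H.nsmul_mem hh m) hmc j hj
      obtain ⟨u, v, huv⟩ := Int.isCoprime_iff_gcd_eq_one.2 (by simpa using hm :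
        Int.gcd (m : ℤ) p = 1)
      have : N • φ h = u • N • φ (m • h) + v • N • φ (p • h) := by
        rw [← map_nsmul, ← map_nsmul, ← map_nsmul, ← map_zsmul, ← map_zsmul, ← map_add]
        congr 1
        rw [smul_comm N m, smul_comm N p, ← natCast_zsmul _ m, ← natCast_zsmul _ p, ← mul_smul,
          ← mul_smul, ← add_smul, huv, one_smul]
      rw [this]
      refine add_mem (AddSubgroup.mem_sup_right ?_) (AddSubgroup.mem_sup_left ?_)
      · refine zsmul_mem (nsmul_mem ?_ N) u
        rw [hT, ← map_nsmul, ← hj, addOrderOf_nsmul_eq_zero, map_zero]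
      · exact zsmul_mem ((mem_invariantCore.1 (hN.nsmul_mem_invariantCore hh)).2 φ) v
  have hT0 : H.relIndex T = 0 := by
    rw [← AddSubgroup.relIndex_sup_left]
    exact AddSubgroup.relIndex_eq_zero_of_le_right hle hhull
  have haH : ∀ c, Finsupp.linearCombination ℤ (fun i ↦ m i • h' i) c ∈ H := fun c ↦ by
    rw [Finsupp.linearCombination_apply]
    exact AddSubgroup.sum_mem _ fun i _ ↦ H.zsmul_mem (H.nsmul_mem (hh' i) _) _
  have hind' : ∀ c : ℕ →₀ ℤ, Finsupp.linearCombination ℤ (fun i ↦ m i • h' i) c ∈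
      invariantCore N H → ∀ i, (p : ℤ) ∣ c i := fun c hc i ↦ by
    by_cases hi : i ∈ c.support
    · have := hind c.support (fun i ↦ c i * m i)
        (by simpa [Finsupp.linearCombination_apply, Finsupp.sum, mul_smul] using hc) i hi
      exact (Nat.isCoprime_iff_coprime.2 (hm i).symm).dvd_of_dvd_mul_right this
    · simp [Finsupp.notMem_support_iff.1 hi]
  refine hH.relIndex_ne_zero_of_lift (K := T)
    (Finsupp.linearCombination ℤ fun i ↦ m i • h' i).toAddMonoidHom haH (fun y hy c hc ↦ ?_) hT0
  have hc0 : Finsupp.linearCombination ℤ (fun i ↦ m i • h' i) c = 0 := hc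
  -- While `k < e`, the combination with coefficients `c'` has order dividing `p ^ k`, hence lies in
  -- the core, and independence extracts another factor `p`.
  have key : ∀ k ≤ e, ∃ c', c = (p ^ k : ℕ) • c' := by
    intro k
    induction k with
    | zero => exact fun _ ↦ ⟨c, by simp⟩
    | succ k ih =>
      intro hk
      obtain ⟨c', rfl⟩ := ih (by omega)
      have hc' : Finsupp.linearCombination ℤ (fun i ↦ m i • h' i) c' ∈ invariantCore N H := by
        by_contra hn
        rw [map_nsmul] at hc0
        obtain ⟨j, hj, hj'⟩ := (Nat.dvd_prime_pow hp).1 (addOrderOf_dvd_of_nsmul_eq_zero hc0)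
        have := he _ (haH c') hn j hj'
        omega
      choose q hq using hind' c' hc'
      refine ⟨c'.mapRange (· / (p : ℤ)) (by simp), ?_⟩
      ext i
      simp only [Finsupp.smul_apply, Finsupp.mapRange_apply]
      rw [pow_succ, mul_smul, hq i, Int.mul_ediv_cancel_left _ (by exact_mod_cast hp.ne_zero)]
      simp
  obtain ⟨c', rfl⟩ := key e le_rfl
  change Finsupp.linearCombination ℤ y (p ^ e • c') = 0
  rw [map_nsmul, Finsupp.linearCombination_apply, Finsupp.sum, Finset.smul_sum]
  exact Finset.sum_eq_zero fun i _ ↦ by rw [smul_comm, (hT _).1 (hy i), smul_zero]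

/-- `H` is quantified after `N` because the induction replaces it by its hull or core. -/
theorem IsFullyInert.exists_commensurable_of_isInvariantUpTo (N : ℕ) :
    ∀ H : AddSubgroup D, IsFullyInert H → (∀ h ∈ H, IsOfFinAddOrder h) → 0 < N →
      IsInvariantUpTo N H → ∃ K : AddSubgroup D, IsFullyInvariant K ∧ H.Commensurable K := by
  induction N using induction_on_primes with
  | zero => exact fun _ _ _ h ↦ (lt_irrefl 0 h).elim
  | one =>
    refine fun H _ _ _ hN ↦ ⟨H, fun φ ↦ ?_, .refl H⟩
    rintro _ ⟨h, hh, rfl⟩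
    simpa using hN φ h hh
  | prime_mul p N hp ih =>
    intro H hH ht hpos hN
    have hpos' : 0 < N := Nat.pos_of_mul_pos_left hpos
    rcases hH.relIndex_invariantHull_or_invariantCore hp ht hN with h | h
    · have hcomm : H.Commensurable (invariantHull N H) :=
        ⟨h, by rw [AddSubgroup.relIndex_eq_one.2 (le_invariantHull N H)]; exact one_ne_zero⟩
      obtain ⟨K, hK, hKc⟩ := ih _ (hH.of_commensurable hcomm)
        (isOfFinAddOrder_of_mem_invariantHull ht) hpos' (isInvariantUpTo_invariantHull N H)
      exact ⟨K, hK, hcomm.trans hKc⟩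
    · have hcomm : H.Commensurable (invariantCore N H) :=
        ⟨by rw [AddSubgroup.relIndex_eq_one.2 (invariantCore_le N H)]; exact one_ne_zero, h⟩
      obtain ⟨K, hK, hKc⟩ := ih _ (hH.of_commensurable hcomm)
        (fun h hh ↦ ht h (mem_invariantCore.1 hh).1) hpos' (isInvariantUpTo_invariantCore N H)
      exact ⟨K, hK, hcomm.trans hKc⟩

theorem IsFullyInert.exists_commensurable_of_torsion {H : AddSubgroup D} (hH : IsFullyInert H)
    (ht : ∀ h ∈ H, IsOfFinAddOrder h) :
    ∃ K : AddSubgroup D, IsFullyInvariant K ∧ H.Commensurable K := by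
  obtain ⟨N, hpos, hN⟩ := hH.exists_isInvariantUpTo ht
  exact exists_commensurable_of_isInvariantUpTo N H hH ht hpos hN

end Divisible

/-! ### Passage to the torsion subgroup, and the role of the rank. -/

section Divisible

variable {D : Type u} [AddCommGroup D] [DivisibleBy D ℤ]

theorem IsFullyInvariant.eq_top {K : AddSubgroup D} (hK : IsFullyInvariant K) {x : D}
    (hxK : x ∈ K) (hx : ¬ IsOfFinAddOrder x) : K = ⊤ :=
  IsInvariantUpTo.eq_top one_pos
    (fun φ _ hh ↦ by rw [one_smul]; exact hK φ (AddSubgroup.mem_map_of_mem φ hh)) hxK hx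

theorem isFullyInvariant_top {A : Type*} [AddCommGroup A] :
    IsFullyInvariant (⊤ : AddSubgroup A) := fun _ ↦ le_top

theorem top_mem_invSim {A : Type*} [AddCommGroup A] : (⊤ : AddSubgroup A) ∈ invSim A :=
  ⟨⊤, isFullyInvariant_top, .refl _⟩

theorem IsFullyInvariant.map_torsion_subtype {A : Type*} [AddCommGroup A]
    {K : AddSubgroup (AddCommGroup.torsion A)} (hK : IsFullyInvariant K) :
    IsFullyInvariant (K.map (AddCommGroup.torsion A).subtype) := fun φ ↦ by
  rintro _ ⟨_, ⟨x, hx, rfl⟩, rfl⟩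
  let f : AddCommGroup.torsion A →+ AddCommGroup.torsion A :=
    (φ.comp (AddCommGroup.torsion A).subtype).codRestrict (AddCommGroup.torsion A)
      fun y ↦ AddMonoidHom.isOfFinAddOrder φ y.2
  exact ⟨f x, hK f (AddSubgroup.mem_map_of_mem f hx), rfl⟩

theorem IsFullyInvariant.addSubgroupOf {K L : AddSubgroup D} (hK : IsFullyInvariant K) :
    IsFullyInvariant (K.addSubgroupOf L) := fun φ ↦ by
  rintro _ ⟨x, hx, rfl⟩
  obtain ⟨Φ, hΦ⟩ := exists_extension L.subtype (L.subtype.comp φ)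
    (by rw [AddSubgroup.ker_subtype]; exact bot_le)
  rw [AddSubgroup.mem_addSubgroupOf]
  rw [← show Φ x = φ x from hΦ x]
  exact hK Φ (AddSubgroup.mem_map_of_mem Φ hx)

theorem map_torsion_invSim_union_top :
    (AddSubgroup.map (AddCommGroup.torsion D).subtype '' invSim (AddCommGroup.torsion D)) ∪ {⊤} =
      invSim D := by
  refine Set.Subset.antisymm ?_ ?_
  · rintro _ (⟨H, ⟨K, hK, hHK⟩, rfl⟩ | rfl)
    · refine ⟨_, hK.map_torsion_subtype, ?_, ?_⟩ <;>
        rw [AddSubgroup.relIndex_map_map_of_injective _ _ (AddSubgroup.subtype_injective _)]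
      exacts [hHK.1, hHK.2]
    · exact top_mem_invSim
  · rintro H ⟨K, hK, hHK⟩
    by_cases ht : ∀ x ∈ K, IsOfFinAddOrder x
    · have htH : H ≤ AddCommGroup.torsion D := fun x hx ↦ by
        have h1 := exists_nsmul_mem_of_relIndex_le hHK.2 le_rfl hx
        exact IsOfFinAddOrder.of_nsmul (ht _ h1) (Nat.factorial_ne_zero _)
      refine Or.inl ⟨H.addSubgroupOf (AddCommGroup.torsion D),
        ⟨K.addSubgroupOf (AddCommGroup.torsion D), hK.addSubgroupOf, ?_, ?_⟩, ?_⟩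
      · rw [AddSubgroup.relIndex_addSubgroupOf ht]; exact hHK.1
      · rw [AddSubgroup.relIndex_addSubgroupOf htH]; exact hHK.2
      · rw [AddSubgroup.addSubgroupOf_map_subtype, inf_eq_left.2 htH]
    · push Not at ht
      obtain ⟨x, hxK, hx⟩ := ht
      obtain rfl := hK.eq_top hxK hx
      exact Or.inr (eq_top_of_relIndex_top_ne_zero hHK.1)

theorem mem_invSim_of_isFullyInert {H : AddSubgroup D} (hH : IsFullyInert H)
    (htop : ∀ x ∈ H, ¬ IsOfFinAddOrder x → H = ⊤) : H ∈ invSim D := by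
  by_cases ht : ∀ x ∈ H, IsOfFinAddOrder x
  · exact hH.exists_commensurable_of_torsion ht
  · push Not at ht
    obtain ⟨x, hxH, hx⟩ := ht
    rw [htop x hxH hx]
    exact top_mem_invSim

theorem inClassIStar_of_divisible : InClassIStar D := by
  refine Set.Subset.antisymm ?_ fun H hH ↦ ?_
  · rintro H ⟨K, hK, hHK⟩
    exact hK.isUniformlyFullyInert_of_commensurable hHK
  · refine mem_invSim_of_isFullyInert (IsUniformlyFullyInert.isFullyInert hH) fun x hxH hx ↦ ?_
    obtain ⟨N, hN, hN'⟩ := IsUniformlyFullyInert.exists_isInvariantUpTo hH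
    exact hN'.eq_top hN hxH hx

theorem exists_linearIndependent_of_aleph0_le_rank {A : Type*} [AddCommGroup A]
    (h : Cardinal.aleph0 ≤ Module.rank ℤ A) : ∃ d : ℕ → A, LinearIndependent ℤ d := by
  obtain ⟨s, hs, hind⟩ := exists_set_linearIndependent ℤ A
  rw [← hs, Cardinal.aleph0_le_mk_iff] at h
  exact ⟨_, hind.comp _ (Infinite.natEmbedding s).injective⟩

/-- Modulo this subgroup, its image under `φ` is covered by a finitely generated group whose
quotient is torsion, hence finite. -/
theorem isFullyInert_torsion_sup_closure {A : Type*} [AddCommGroup A] {s : Set A} (hs : s.Finite)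
    (h : ∀ a : A, ∃ n : ℕ, 0 < n ∧ n • a ∈ AddCommGroup.torsion A ⊔ AddSubgroup.closure s) :
    IsFullyInert (AddCommGroup.torsion A ⊔ AddSubgroup.closure s) := fun φ ↦ by
  let C := AddSubgroup.closure (φ '' s)
  have hle : (AddCommGroup.torsion A ⊔ AddSubgroup.closure s).map φ ≤
      (AddCommGroup.torsion A ⊔ AddSubgroup.closure s) ⊔ C := by
    rw [AddSubgroup.map_sup, AddMonoidHom.map_closure]
    refine sup_le ?_ le_sup_right
    rintro _ ⟨x, hx, rfl⟩
    exact AddSubgroup.mem_sup_left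
      (AddSubgroup.mem_sup_left (AddMonoidHom.isOfFinAddOrder φ hx))
  intro h0
  have h1 := AddSubgroup.relIndex_eq_zero_of_le_right hle h0
  rw [AddSubgroup.relIndex_sup_left] at h1
  have : AddGroup.FG C := (AddGroup.fg_iff_addSubgroup_fg C).2
    ((AddSubgroup.fg_iff _).2 ⟨_, rfl, hs.image φ⟩)
  have := AddCommGroup.finite_of_fg_isAddTorsion
    (C ⧸ (AddCommGroup.torsion A ⊔ AddSubgroup.closure s).addSubgroupOf C) fun q ↦ by
      induction q using QuotientAddGroup.induction_on with
      | H y =>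
        obtain ⟨n, hn, hy⟩ := h y
        refine isOfFinAddOrder_iff_nsmul_eq_zero.2 ⟨n, hn, ?_⟩
        rw [← QuotientAddGroup.mk_nsmul, QuotientAddGroup.eq_zero_iff,
          AddSubgroup.mem_addSubgroupOf]
        exact hy
  exact (AddSubgroup.finiteIndex_of_finite_quotient (H :=
    (AddCommGroup.torsion A ⊔ AddSubgroup.closure s).addSubgroupOf C)).index_ne_zero h1

theorem fullyInertSubgroups_ne_of_rank (hpos : 0 < torsionFreeRank D)
    (hfin : torsionFreeRank D < Cardinal.aleph0) :
    fullyInertSubgroups D ≠ uniformlyFullyInertSubgroups D := by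
  intro heq
  obtain ⟨s, hs, hmax⟩ := exists_maximal_linearIndepOn ℤ (id : D → D)
  rw [Set.image_id] at hmax
  have hsfin : s.Finite :=
    Set.finite_coe_iff.1 (Cardinal.lt_aleph0_iff_finite.1 (hs.cardinal_le_rank.trans_lt hfin))
  have hmem : ∀ {x}, x ∈ Submodule.span ℤ s ↔ x ∈ AddSubgroup.closure s := fun {x} ↦ by
    rw [← Submodule.span_int_eq_addSubgroupClosure]; rfl
  have hH : IsFullyInert (AddCommGroup.torsion D ⊔ AddSubgroup.closure s) := by
    refine isFullyInert_torsion_sup_closure hsfin fun a ↦ ?_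
    by_cases ha : a ∈ s
    · exact ⟨1, one_pos, AddSubgroup.mem_sup_right (by
        rw [one_smul]; exact AddSubgroup.subset_closure ha)⟩
    · obtain ⟨n, hn, hmemn⟩ := hmax a ha
      refine ⟨n.natAbs, Int.natAbs_pos.2 hn, AddSubgroup.mem_sup_right (hmem.1 ?_)⟩
      rw [← natCast_zsmul]
      rcases Int.natAbs_eq n with h | h
      · rw [← h]; exact hmemn
      · rw [h, neg_smul, neg_mem_iff] at hmemn; exact hmemn
  obtain ⟨x, hx⟩ : s.Nonempty := by
    rw [Set.nonempty_iff_ne_empty]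
    rintro rfl
    refine hpos.ne' (rank_eq_zero_iff.2 fun x ↦ ?_)
    simpa using hmax x (Set.notMem_empty x)
  -- Compare coefficients at `x`. With `m = 0` this shows that `x` has infinite order; with `m = 2 *
  -- n` it excludes a half of `x` from the subgroup.
  have hindx : ∀ (n m : ℤ) (y : D), y ∈ AddSubgroup.closure s → n • x = m • y → m ∣ n := by
    intro n m y hy hxy
    obtain ⟨c, rfl⟩ := (Finsupp.mem_span_iff_linearCombination ℤ s y).1 (hmem.2 hy)
    have h0 : Finsupp.single ⟨x, hx⟩ n - m • c = 0 := by
      refine linearIndependent_iff.1 (show LinearIndependent ℤ ((↑) : s → D) from hs) _ ?_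
      rw [map_sub, map_smul, Finsupp.linearCombination_single, hxy, sub_self]
    refine ⟨c ⟨x, hx⟩, ?_⟩
    simpa [sub_eq_zero] using DFunLike.congr_fun h0 ⟨x, hx⟩
  have hxinf : ¬ IsOfFinAddOrder x := fun hfin ↦ by
    obtain ⟨n, hn, h⟩ := isOfFinAddOrder_iff_nsmul_eq_zero.1 hfin
    have := hindx n 0 0 (zero_mem _) (by simpa using h)
    exact hn.ne' (by simpa using this)
  have hunif : IsUniformlyFullyInert (AddCommGroup.torsion D ⊔ AddSubgroup.closure s) := by
    have : (AddCommGroup.torsion D ⊔ AddSubgroup.closure s) ∈ fullyInertSubgroups D := hH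
    rwa [heq] at this
  obtain ⟨N, hN, hN'⟩ := hunif.exists_isInvariantUpTo
  have htop := hN'.eq_top hN (AddSubgroup.mem_sup_right (AddSubgroup.subset_closure hx)) hxinf
  obtain ⟨y, hy⟩ := exists_nsmul_eq two_pos x
  obtain ⟨t, ht, z, hz, rfl⟩ := AddSubgroup.mem_sup.1 (htop ▸ AddSubgroup.mem_top y)
  obtain ⟨n, hn, hnt⟩ := isOfFinAddOrder_iff_nsmul_eq_zero.1 ht
  have h2 := hindx n (n * 2) z hz (by
    rw [← hy, smul_add, smul_add, mul_smul]
    have : (n : ℤ) • 2 • t = 0 := by rw [smul_comm, natCast_zsmul, hnt, smul_zero]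
    rw [this, zero_add]
    congr 1
    exact (natCast_zsmul z 2).symm)
  have h3 : (n : ℤ) * 2 ∣ n * 1 := by simpa using h2
  have := Int.dvd_of_mul_dvd_mul_left (by exact_mod_cast hn.ne') h3
  norm_num at this

end Divisible

end FullyInert

theorem mainTheorem2 {D : Type*} [AddCommGroup D] [DivisibleBy D ℤ] :
    FullyInert.InClassIStar D ∧
    (∀ H : AddSubgroup D, FullyInert.IsUniformlyFullyInert H →
      ∃ K : AddSubgroup D, FullyInert.IsFullyInvariant K ∧ H.Commensurable K) ∧
    (AddSubgroup.map (AddCommGroup.torsion D).subtype ''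
        FullyInert.invSim (AddCommGroup.torsion D)) ∪ {⊤} = FullyInert.invSim D ∧
    (0 < FullyInert.torsionFreeRank D ∧ FullyInert.torsionFreeRank D < Cardinal.aleph0 →
      FullyInert.fullyInertSubgroups D ≠ FullyInert.uniformlyFullyInertSubgroups D ∧
      FullyInert.uniformlyFullyInertSubgroups D = FullyInert.invSim D) ∧
    (¬ (0 < FullyInert.torsionFreeRank D ∧ FullyInert.torsionFreeRank D < Cardinal.aleph0) →
      FullyInert.fullyInertSubgroups D = FullyInert.uniformlyFullyInertSubgroups D ∧
      FullyInert.uniformlyFullyInertSubgroups D = FullyInert.invSim D ∧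
      FullyInert.InClassI D) := by
  have hstar : FullyInert.invSim D = FullyInert.uniformlyFullyInertSubgroups D :=
    FullyInert.inClassIStar_of_divisible
  refine ⟨hstar, fun H hH ↦ hstar.superset hH, FullyInert.map_torsion_invSim_union_top,
    fun h ↦ ⟨FullyInert.fullyInertSubgroups_ne_of_rank h.1 h.2, hstar.symm⟩, fun h ↦ ?_⟩
  have hI : FullyInert.fullyInertSubgroups D = FullyInert.invSim D := by
    refine Set.Subset.antisymm (fun H hH ↦ ?_) fun H hH ↦
      FullyInert.IsUniformlyFullyInert.isFullyInert (hstar.subset hH)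
    refine FullyInert.mem_invSim_of_isFullyInert hH fun x hxH hx ↦ ?_
    have hpos : 0 < FullyInert.torsionFreeRank D := by
      refine pos_iff_ne_zero.2 fun h0 ↦ hx ?_
      exact isOfFinAddOrder_iff_zsmul_eq_zero.2 (rank_eq_zero_iff.1 h0 x)
    obtain ⟨d, hd⟩ := FullyInert.exists_linearIndependent_of_aleph0_le_rank
      (not_lt.1 fun hlt ↦ h ⟨hpos, hlt⟩)
    exact FullyInert.IsFullyInert.eq_top_of_linearIndependent hH hd hxH hx
  exact ⟨hI.trans hstar, hstar.symm, hI⟩
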